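/- Let $M$ be a smooth manifold, let $(A,[\cdot,\cdot],\rho)$ be a Lie algebroid over $M$ (a smooth real vector bundle of finite rank), let $\pi\in\Gamma(\bigwedge^2A)$ be a Poisson bivector, i.e. $[\pi,\pi]_{SN}=0$ for the Schouten–Nijenhuis bracket, and let $\omega\in\Gamma(\bigwedge^2A^*)$ be an arbitrary $2$-form. Put $\pi^\sharp(\alpha)=\pi(\alpha,\cdot)$, $\omega^\flat(X)=\omega(X,\cdot)$, $N=\pi^\sharp\circ\omega^\flat\in\Gamma(A\otimes A^*)$, $\omega_N(X,Y)=\omega(NX,Y)$. Then $\omega_N$ is a $2$-form, and $(\pi,N,\psi,H)$ with $\psi=d\omega_N$ and $H=-d\omega$ is a Poisson quasi-Nijenhuis structure with background on $A$. This means: $N\circ\pi^\sharp=\pi^\sharp\circ{}^tN$, $d\psi=0$, $dH=0$, the bivector $\pi$ is Poisson, and for all $X,Y\in\Gamma(A)$, $\alpha,\beta\in\Gamma(A^*)$, $$C_{\pi,N}(\alpha,\beta)=2\,H(\pi^\sharp\alpha,\pi^\sharp\beta,\cdot),$$ $$T_N(X,Y)=-\pi^\sharp\big(H(NX,Y,\cdot)-H(NY,X,\cdot)+\psi(X,Y,\cdot)\big),$$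 $$d_N\psi=d\mathcal H,\qquad \mathcal H(X,Y,Z)=H(NX,NY,Z)+H(NY,NZ,X)+H(NZ,NX,Y).$$ Here $d$ is the Lie algebroid differential (given by the Koszul formula without numerical factor, e.g. $df(X)=\rho(X)f$); $d_N$ is given by the same formula with the bracket $[X,Y]_N=[NX,Y]+[X,NY]-N[X,Y]$ and the anchor $\rho\circ N$; $T_N(X,Y)=[NX,NY]-N[X,Y]_N$; ${}^tN\alpha=\alpha\circ N$; $[\alpha,\beta]_\pi=\mathcal L_{\pi^\sharp\alpha}\beta-\mathcal L_{\pi^\sharp\beta}\alpha-d(\pi(\alpha,\beta))$; and $C_{\pi,N}=([\cdot,\cdot]_N)_\pi-([\cdot,\cdot]_\pi)_{{}^tN}$, where $([\cdot,\cdot]_N)_\pi$ is obtained from the formula for $[\cdot,\cdot]_\pi$ by replacing the bracket and anchor of $A$ by $[\cdot,\cdot]_N$ and $\rho\circ N$ (also in $\mathcal L$ and $d$), and $([\alpha,\beta]_\pi)_{{}^tN}=[{}^tN\alpha,\beta]_\pi+[\alpha,{}^tN\beta]_\pi-{}^tN[\alpha,\beta]_\pi$. -/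

import Mathlib

open scoped Manifold

/-!
# Differential calculus of a bracket and an anchor on a module

In this part `R` plays the role of the ring `C^∞(M)` of smooth functions and `L` that of the
`C^∞(M)`-module `Γ(A)` of smooth sections of a vector bundle `A → M` of finite rank. Sections of the
tensor bundles of `A` are written, as usual, as `C^∞(M)`-multilinear objects:
* `Γ(A*)` is `Module.Dual R L`;
* `Γ(⋀ᵏ A*)` is the module of alternating `R`-multilinear maps from `k` copies of `L` to `R`;
* `Γ(A ⊗ A*)` is the module of `R`-linear endomorphisms of `L`;
* `Γ(⋀² A)` is the set of skew-symmetric `R`-linear maps `Γ(A*) → Γ(A)`.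
-/

noncomputable section

namespace PqN

/-- `k`-forms. -/
abbrev KForm (R L : Type*) [CommRing R] [AddCommGroup L] [Module R L] (k : ℕ) : Type _ :=
  L [⋀^Fin k]→ₗ[R] R

section Forms

variable {R L : Type*} [CommRing R] [AddCommGroup L] [Module R L]

theorem KForm.add₂ (η : KForm R L 2) (x y y' : L) : η ![x, y + y'] = η ![x, y] + η ![x, y'] := by
  have e : ∀ w, Function.update ![x, y] (1 : Fin 2) w = ![x, w] := fun w => by
    funext j; fin_cases j <;> rfl
  have h := η.map_update_add ![x, y] (1 : Fin 2) y y'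
  rwa [e, e, e] at h

theorem KForm.smul₂ (η : KForm R L 2) (x y : L) (f : R) : η ![x, f • y] = f * η ![x, y] := by
  have e : ∀ w, Function.update ![x, y] (1 : Fin 2) w = ![x, w] := fun w => by
    funext j; fin_cases j <;> rfl
  have h := η.map_update_smul ![x, y] (1 : Fin 2) f y
  rwa [e, e] at h

theorem KForm.self₂ (η : KForm R L 2) (x : L) : η ![x, x] = 0 :=
  η.map_eq_zero_of_eq ![x, x] (i := 0) (j := 1) (by simp) (by decide)

theorem KForm.add₁ (η : KForm R L 2) (x x' y : L) : η ![x + x', y] = η ![x, y] + η ![x', y] := by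
  have e : ∀ w, Function.update ![x, y] (0 : Fin 2) w = ![w, y] := fun w => by
    funext j; fin_cases j <;> rfl
  have h := η.map_update_add ![x, y] (0 : Fin 2) x x'
  rwa [e, e, e] at h

theorem KForm.smul₁ (η : KForm R L 2) (x y : L) (f : R) : η ![f • x, y] = f * η ![x, y] := by
  have e : ∀ w, Function.update ![x, y] (0 : Fin 2) w = ![w, y] := fun w => by
    funext j; fin_cases j <;> rfl
  have h := η.map_update_smul ![x, y] (0 : Fin 2) f x
  rwa [e, e] at h

theorem KForm.swap₂ (η : KForm R L 2) (x y : L) : η ![x, y] = -η ![y, x] := by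
  have h := η.self₂ (x + y)
  rw [η.add₁, η.add₂, η.add₂, η.self₂, η.self₂] at h
  linear_combination h

theorem KForm.add₃₁ (η : KForm R L 3) (x x' y z : L) :
    η ![x + x', y, z] = η ![x, y, z] + η ![x', y, z] := by
  have e : ∀ w, Function.update ![x, y, z] (0 : Fin 3) w = ![w, y, z] := fun w => by
    funext j; fin_cases j <;> rfl
  have h := η.map_update_add ![x, y, z] (0 : Fin 3) x x'
  rwa [e, e, e] at h

theorem KForm.smul₃₁ (η : KForm R L 3) (x y z : L) (f : R) :
    η ![f • x, y, z] = f * η ![x, y, z] := by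
  have e : ∀ w, Function.update ![x, y, z] (0 : Fin 3) w = ![w, y, z] := fun w => by
    funext j; fin_cases j <;> rfl
  have h := η.map_update_smul ![x, y, z] (0 : Fin 3) f x
  rwa [e, e] at h

theorem KForm.add₃₂ (η : KForm R L 3) (x y y' z : L) :
    η ![x, y + y', z] = η ![x, y, z] + η ![x, y', z] := by
  have e : ∀ w, Function.update ![x, y, z] (1 : Fin 3) w = ![x, w, z] := fun w => by
    funext j; fin_cases j <;> rfl
  have h := η.map_update_add ![x, y, z] (1 : Fin 3) y y'
  rwa [e, e, e] at h

theorem KForm.smul₃₂ (η : KForm R L 3) (x y z : L) (f : R) :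
    η ![x, f • y, z] = f * η ![x, y, z] := by
  have e : ∀ w, Function.update ![x, y, z] (1 : Fin 3) w = ![x, w, z] := fun w => by
    funext j; fin_cases j <;> rfl
  have h := η.map_update_smul ![x, y, z] (1 : Fin 3) f y
  rwa [e, e] at h

theorem KForm.add₃₃ (η : KForm R L 3) (x y z z' : L) :
    η ![x, y, z + z'] = η ![x, y, z] + η ![x, y, z'] := by
  have e : ∀ w, Function.update ![x, y, z] (2 : Fin 3) w = ![x, y, w] := fun w => by
    funext j; fin_cases j <;> rfl
  have h := η.map_update_add ![x, y, z] (2 : Fin 3) z z'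
  rwa [e, e, e] at h

theorem KForm.smul₃₃ (η : KForm R L 3) (x y z : L) (f : R) :
    η ![x, y, f • z] = f * η ![x, y, z] := by
  have e : ∀ w, Function.update ![x, y, z] (2 : Fin 3) w = ![x, y, w] := fun w => by
    funext j; fin_cases j <;> rfl
  have h := η.map_update_smul ![x, y, z] (2 : Fin 3) f z
  rwa [e, e] at h

theorem KForm.self₃₁₂ (η : KForm R L 3) (x z : L) : η ![x, x, z] = 0 :=
  η.map_eq_zero_of_eq ![x, x, z] (i := 0) (j := 1) (by simp) (by decide)

theorem KForm.self₃₂₃ (η : KForm R L 3) (x z : L) : η ![x, z, z] = 0 :=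
  η.map_eq_zero_of_eq ![x, z, z] (i := 1) (j := 2) (by simp) (by decide)

theorem KForm.self₃₁₃ (η : KForm R L 3) (x y : L) : η ![x, y, x] = 0 :=
  η.map_eq_zero_of_eq ![x, y, x] (i := 0) (j := 2) (by simp) (by decide)

/-- A `2`-form from an alternating biadditive, `R`-bilinear function. -/
def mkForm₂ (f : L → L → R)
    (add₁ : ∀ x x' y, f (x + x') y = f x y + f x' y) (smul₁ : ∀ (c : R) x y, f (c • x) y = c * f x y)
    (add₂ : ∀ x y y', f x (y + y') = f x y + f x y') (smul₂ : ∀ (c : R) x y, f x (c • y) = c * f x y)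
    (self : ∀ x, f x x = 0) : KForm R L 2 where
  toFun v := f (v 0) (v 1)
  map_update_add' {inst} m i x y := by
    rw [Subsingleton.elim inst (instDecidableEqFin 2)]
    fin_cases i <;> simp [add₁, add₂]
  map_update_smul' {inst} m i c x := by
    rw [Subsingleton.elim inst (instDecidableEqFin 2)]
    fin_cases i <;> simp [smul₁, smul₂]
  map_eq_zero_of_eq' v i j h hij := by
    have key : v 0 = v 1 → f (v 0) (v 1) = 0 := fun e => by rw [e, self]
    fin_cases i <;> fin_cases j
    · exact absurd rfl hij
    · exact key h
    · exact key h.symm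
    · exact absurd rfl hij

/-- A `3`-form from an alternating triadditive, `R`-trilinear function. -/
def mkForm₃ (f : L → L → L → R)
    (add₁ : ∀ x x' y z, f (x + x') y z = f x y z + f x' y z)
    (smul₁ : ∀ (c : R) x y z, f (c • x) y z = c * f x y z)
    (add₂ : ∀ x y y' z, f x (y + y') z = f x y z + f x y' z)
    (smul₂ : ∀ (c : R) x y z, f x (c • y) z = c * f x y z)
    (add₃ : ∀ x y z z', f x y (z + z') = f x y z + f x y z')
    (smul₃ : ∀ (c : R) x y z, f x y (c • z) = c * f x y z)
    (self₁₂ : ∀ x z, f x x z = 0) (self₂₃ : ∀ x y, f x y y = 0) (self₁₃ : ∀ x y, f x y x = 0) :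
    KForm R L 3 where
  toFun v := f (v 0) (v 1) (v 2)
  map_update_add' {inst} m i x y := by
    rw [Subsingleton.elim inst (instDecidableEqFin 3)]
    fin_cases i
    · exact add₁ _ _ _ _
    · exact add₂ _ _ _ _
    · exact add₃ _ _ _ _
  map_update_smul' {inst} m i c x := by
    rw [Subsingleton.elim inst (instDecidableEqFin 3)]
    fin_cases i
    · exact smul₁ _ _ _ _
    · exact smul₂ _ _ _ _
    · exact smul₃ _ _ _ _
  map_eq_zero_of_eq' v i j h hij := by
    have h₁₂ : v 0 = v 1 → f (v 0) (v 1) (v 2) = 0 := fun e => by rw [e, self₁₂]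
    have h₂₃ : v 1 = v 2 → f (v 0) (v 1) (v 2) = 0 := fun e => by rw [e, self₂₃]
    have h₁₃ : v 0 = v 2 → f (v 0) (v 1) (v 2) = 0 := fun e => by rw [e, self₁₃]
    fin_cases i <;> fin_cases j
    · exact absurd rfl hij
    · exact h₁₂ h
    · exact h₁₃ h
    · exact h₁₂ h.symm
    · exact absurd rfl hij
    · exact h₂₃ h
    · exact h₁₃ h.symm
    · exact h₂₃ h.symm
    · exact absurd rfl hij

/-- The `1`-form `ω(X, ·)`; the assignment is the map `ω♭`. -/
def flat (ω : KForm R L 2) : L →ₗ[R] Module.Dual R L where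
  toFun X :=
    { toFun := fun Y => ω ![X, Y]
      map_add' := fun Y Y' => ω.add₂ X Y Y'
      map_smul' := fun f Y => ω.smul₂ X Y f }
  map_add' X X' := by ext Y; exact ω.add₁ X X' Y
  map_smul' f X := by ext Y; exact ω.smul₁ X Y f

/-- The `1`-form `η(X, Y, ·)`. -/
def contract (η : KForm R L 3) (X Y : L) : Module.Dual R L where
  toFun Z := η ![X, Y, Z]
  map_add' Z Z' := η.add₃₃ X Y Z Z'
  map_smul' f Z := η.smul₃₃ X Y Z f

/-- The `3`-form `𝓗(X,Y,Z) = H(NX,NY,Z) + H(NY,NZ,X) + H(NZ,NX,Y)`. -/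
def cyclicForm (N : L →ₗ[R] L) (H : KForm R L 3) : KForm R L 3 :=
  mkForm₃ (fun X Y Z => H ![N X, N Y, Z] + H ![N Y, N Z, X] + H ![N Z, N X, Y])
    (by intros; simp only [map_add, H.add₃₁, H.add₃₂, H.add₃₃]; ring)
    (by intros; simp only [map_smul, H.smul₃₁, H.smul₃₂, H.smul₃₃]; ring)
    (by intros; simp only [map_add, H.add₃₁, H.add₃₂, H.add₃₃]; ring)
    (by intros; simp only [map_smul, H.smul₃₁, H.smul₃₂, H.smul₃₃]; ring)
    (by intros; simp only [map_add, H.add₃₁, H.add₃₂, H.add₃₃]; ring)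
    (by intros; simp only [map_smul, H.smul₃₁, H.smul₃₂, H.smul₃₃]; ring)
    (by
      intro x z
      have h := H.self₃₁₂ (N x + N z) x
      simp only [H.add₃₁, H.add₃₂, H.self₃₁₂] at h
      rw [H.self₃₁₂]
      linear_combination h)
    (by
      intro x y
      have h := H.self₃₁₂ (N x + N y) y
      simp only [H.add₃₁, H.add₃₂, H.self₃₁₂] at h
      rw [H.self₃₁₂]
      linear_combination h)
    (by
      intro x y
      have h := H.self₃₁₂ (N x + N y) x
      simp only [H.add₃₁, H.add₃₂, H.self₃₁₂] at h
      rw [H.self₃₁₂]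
      linear_combination h)

end Forms

/-- A bivector `π ∈ Γ(⋀² A)`, given by the skew-symmetric map `π♯ : Γ(A*) → Γ(A)`,
`π♯(α) = π(α, ·)`, that is `β (π♯ α) = π(α, β)`. -/
structure Bivector (R L : Type*) [CommRing R] [AddCommGroup L] [Module R L] where
  sharp : Module.Dual R L →ₗ[R] L
  skew : ∀ α : Module.Dual R L, α (sharp α) = 0

namespace Bivector

variable {R L : Type*} [CommRing R] [AddCommGroup L] [Module R L]

/-- `π(α, β)`. -/
def eval (π : Bivector R L) (α β : Module.Dual R L) : R := β (π.sharp α)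

theorem eval_swap (π : Bivector R L) (α β : Module.Dual R L) :
    β (π.sharp α) = -α (π.sharp β) := by
  have h := π.skew (α + β)
  simp only [map_add, LinearMap.add_apply, π.skew] at h
  linear_combination h

/-- The decomposable bivector `X ∧ Y`, `(X ∧ Y)(α, β) = α(X) β(Y) - α(Y) β(X)`. -/
def wedge (X Y : L) : Bivector R L where
  sharp :=
    { toFun := fun α => α X • Y - α Y • X
      map_add' := fun α β => by simp only [LinearMap.add_apply, add_smul]; abel
      map_smul' := fun f α => by simp [mul_smul, smul_sub] }
  skew α := by simp [mul_comm]

/-- The endomorphism `N = π♯ ∘ ω♭`. -/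
def endo (π : Bivector R L) (ω : KForm R L 2) : L →ₗ[R] L := π.sharp ∘ₗ flat ω

/-- The `2`-form `ω_N(X, Y) = ω(NX, Y)`, where `N = π♯ ∘ ω♭`. -/
def twistedForm (π : Bivector R L) (ω : KForm R L 2) : KForm R L 2 :=
  mkForm₂ (fun X Y => ω ![π.endo ω X, Y])
    (by intros; simp only [map_add, ω.add₁]) (by intros; simp only [map_smul, ω.smul₁])
    (by intros; simp only [ω.add₂]) (by intros; simp only [ω.smul₂])
    (by
      intro X
      have h : ω ![X, π.endo ω X] = 0 := π.skew (flat ω X)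
      rw [ω.swap₂, h, neg_zero])

end Bivector

/-- A skew-symmetric biadditive bracket on `L` with an `R`-linear anchor, satisfying the Leibniz
rule; no Jacobi identity is required. Examples are a Lie algebroid and its deformation by an
arbitrary `(1,1)`-tensor. -/
structure SkewAlgebroid (R L : Type*) [CommRing R] [Algebra ℝ R] [AddCommGroup L] [Module R L] where
  bracket : L → L → L
  anchor : L →ₗ[R] Derivation ℝ R R
  add_bracket : ∀ X X' Y, bracket (X + X') Y = bracket X Y + bracket X' Y
  bracket_add : ∀ X Y Y', bracket X (Y + Y') = bracket X Y + bracket X Y'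
  bracket_self : ∀ X, bracket X X = 0
  leibniz : ∀ (X Y : L) (f : R), bracket X (f • Y) = f • bracket X Y + anchor X f • Y

namespace SkewAlgebroid

variable {R L : Type*} [CommRing R] [Algebra ℝ R] [AddCommGroup L] [Module R L]

theorem bracket_swap (𝒜 : SkewAlgebroid R L) (X Y : L) : 𝒜.bracket X Y = -𝒜.bracket Y X := by
  have h := 𝒜.bracket_self (X + Y)
  rw [𝒜.add_bracket, 𝒜.bracket_add, 𝒜.bracket_add, 𝒜.bracket_self, 𝒜.bracket_self, zero_add,
    add_zero] at h
  exact eq_neg_of_add_eq_zero_left h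

theorem leibniz_left (𝒜 : SkewAlgebroid R L) (X Y : L) (f : R) :
    𝒜.bracket (f • X) Y = f • 𝒜.bracket X Y - 𝒜.anchor Y f • X := by
  rw [𝒜.bracket_swap, 𝒜.leibniz, 𝒜.bracket_swap Y X]
  module

/-- The differential `df` of a function: `(df)(X) = ρ(X) f`. -/
def d₀ (𝒜 : SkewAlgebroid R L) (f : R) : Module.Dual R L where
  toFun X := 𝒜.anchor X f
  map_add' X Y := by simp
  map_smul' g X := by simp

/-- The Lie derivative of a `1`-form: `(𝓛_X α)(Y) = ρ(X)(α(Y)) - α([X, Y])`. -/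
def lieDeriv (𝒜 : SkewAlgebroid R L) (X : L) (α : Module.Dual R L) : Module.Dual R L where
  toFun Y := 𝒜.anchor X (α Y) - α (𝒜.bracket X Y)
  map_add' Y Y' := by simp only [map_add, 𝒜.bracket_add]; ring
  map_smul' f Y := by
    simp only [map_smul, smul_eq_mul, Derivation.leibniz, 𝒜.leibniz, map_add, RingHom.id_apply]
    ring

/-- The differential of a `2`-form. -/
def d₂ (𝒜 : SkewAlgebroid R L) (ω : KForm R L 2) : KForm R L 3 :=
  mkForm₃
    (fun X Y Z => 𝒜.anchor X (ω ![Y, Z]) - 𝒜.anchor Y (ω ![X, Z]) + 𝒜.anchor Z (ω ![X, Y])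
      - ω ![𝒜.bracket X Y, Z] + ω ![𝒜.bracket X Z, Y] - ω ![𝒜.bracket Y Z, X])
    (by
      intros
      simp only [map_add, Derivation.add_apply, 𝒜.add_bracket, 𝒜.bracket_add, ω.add₁, ω.add₂]
      ring)
    (by
      intro c x y z
      simp only [map_smul, Derivation.smul_apply, smul_eq_mul, Derivation.leibniz, 𝒜.leibniz_left,
        𝒜.leibniz, sub_eq_add_neg, ← neg_smul, ω.add₁, ω.add₂, ω.smul₁, ω.smul₂]
      rw [ω.swap₂ x y]
      ring)
    (by
      intros
      simp only [map_add, Derivation.add_apply, 𝒜.add_bracket, 𝒜.bracket_add, ω.add₁, ω.add₂]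
      ring)
    (by
      intro c x y z
      simp only [map_smul, Derivation.smul_apply, smul_eq_mul, Derivation.leibniz, 𝒜.leibniz_left,
        𝒜.leibniz, sub_eq_add_neg, ← neg_smul, ω.add₁, ω.add₂, ω.smul₁, ω.smul₂]
      rw [ω.swap₂ x y]
      ring)
    (by
      intros
      simp only [map_add, Derivation.add_apply, 𝒜.add_bracket, 𝒜.bracket_add, ω.add₁, ω.add₂]
      ring)
    (by
      intro c x y z
      simp only [map_smul, Derivation.smul_apply, smul_eq_mul, Derivation.leibniz, 𝒜.leibniz_left,
        𝒜.leibniz, sub_eq_add_neg, ← neg_smul, ω.add₁, ω.add₂, ω.smul₁, ω.smul₂]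
      rw [ω.swap₂ z y, ω.swap₂ z x]
      ring)
    (by
      intro x z
      have h : ω ![𝒜.bracket x x, z] = 0 := by
        rw [𝒜.bracket_self]
        exact ω.map_coord_zero (m := ![0, z]) 0 rfl
      rw [ω.self₂, map_zero, h]
      ring)
    (by
      intro x y
      have h : ω ![𝒜.bracket y y, x] = 0 := by
        rw [𝒜.bracket_self]
        exact ω.map_coord_zero (m := ![0, x]) 0 rfl
      rw [ω.self₂, map_zero, h]
      ring)
    (by
      intro x y
      have h : ω ![𝒜.bracket x x, y] = 0 := by
        rw [𝒜.bracket_self]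
        exact ω.map_coord_zero (m := ![0, y]) 0 rfl
      have h' : ω ![𝒜.bracket x y, x] + ω ![𝒜.bracket y x, x] = 0 := by
        rw [← ω.add₁, 𝒜.bracket_swap x y, neg_add_cancel]
        exact ω.map_coord_zero (m := ![0, x]) 0 rfl
      rw [ω.self₂, map_zero, h, ω.swap₂ y x, map_neg]
      linear_combination -h')

/-- The differential of a `3`-form, evaluated on four sections. -/
def d₃ (𝒜 : SkewAlgebroid R L) (η : KForm R L 3) (W X Y Z : L) : R :=
  𝒜.anchor W (η ![X, Y, Z]) - 𝒜.anchor X (η ![W, Y, Z])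
    + 𝒜.anchor Y (η ![W, X, Z]) - 𝒜.anchor Z (η ![W, X, Y])
    - η ![𝒜.bracket W X, Y, Z] + η ![𝒜.bracket W Y, X, Z] - η ![𝒜.bracket W Z, X, Y]
    - η ![𝒜.bracket X Y, W, Z] + η ![𝒜.bracket X Z, W, Y] - η ![𝒜.bracket Y Z, W, X]

/-- The deformation by `N`: bracket `[X,Y]_N = [NX,Y] + [X,NY] - N[X,Y]` and anchor `ρ ∘ N`.
Its differential is `d_N`. -/
def deform (𝒜 : SkewAlgebroid R L) (N : L →ₗ[R] L) : SkewAlgebroid R L where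
  bracket X Y := 𝒜.bracket (N X) Y + 𝒜.bracket X (N Y) - N (𝒜.bracket X Y)
  anchor := 𝒜.anchor ∘ₗ N
  add_bracket X X' Y := by simp only [map_add, 𝒜.add_bracket]; abel
  bracket_add X Y Y' := by simp only [map_add, 𝒜.bracket_add]; abel
  bracket_self X := by rw [𝒜.bracket_self, 𝒜.bracket_swap X (N X), map_zero]; abel
  leibniz X Y f := by
    simp only [map_smul, 𝒜.leibniz, map_add, LinearMap.comp_apply]
    module

/-- The Nijenhuis torsion `T_N(X,Y) = [NX,NY] - N([NX,Y] + [X,NY] - N[X,Y])`. -/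
def torsion (𝒜 : SkewAlgebroid R L) (N : L →ₗ[R] L) (X Y : L) : L :=
  𝒜.bracket (N X) (N Y)
    - N (𝒜.bracket (N X) Y + 𝒜.bracket X (N Y) - N (𝒜.bracket X Y))

/-- The bracket `[α,β]_π = 𝓛_{π♯α} β - 𝓛_{π♯β} α - d(π(α,β))` of `1`-forms. -/
def formBracket (𝒜 : SkewAlgebroid R L) (π : Bivector R L) (α β : Module.Dual R L) :
    Module.Dual R L :=
  𝒜.lieDeriv (π.sharp α) β - 𝒜.lieDeriv (π.sharp β) α - 𝒜.d₀ (π.eval α β)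

/-- `C_{π,N} = ([·,·]_N)_π - ([·,·]_π)_{ᵗN}`, where `ᵗN α = α ∘ N`. -/
def concomitant (𝒜 : SkewAlgebroid R L) (π : Bivector R L) (N : L →ₗ[R] L)
    (α β : Module.Dual R L) : Module.Dual R L :=
  (𝒜.deform N).formBracket π α β
    - (𝒜.formBracket π (α ∘ₗ N) β + 𝒜.formBracket π α (β ∘ₗ N) - 𝒜.formBracket π α β ∘ₗ N)

/-- The Schouten-Nijenhuis bracket `[P, Q]` of two bivectors, a trivector, evaluated on three
`1`-forms. See `schouten_wedge` for its value on decomposable bivectors. -/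
def schouten (𝒜 : SkewAlgebroid R L) (P Q : Bivector R L) (α β γ : Module.Dual R L) : R :=
  (𝒜.lieDeriv (P.sharp α) β (Q.sharp γ) + 𝒜.lieDeriv (Q.sharp α) β (P.sharp γ))
  + (𝒜.lieDeriv (P.sharp β) γ (Q.sharp α) + 𝒜.lieDeriv (Q.sharp β) γ (P.sharp α))
  + (𝒜.lieDeriv (P.sharp γ) α (Q.sharp β) + 𝒜.lieDeriv (Q.sharp γ) α (P.sharp β))

/-- The Schouten-Nijenhuis bracket satisfies
`[X∧Y, Z∧W] = [X,Z]∧Y∧W - [X,W]∧Y∧Z - [Y,Z]∧X∧W + [Y,W]∧X∧Z`. -/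
theorem schouten_wedge (𝒜 : SkewAlgebroid R L) (X Y Z W : L) (α β γ : Module.Dual R L) :
    let tri : L → L → L → R := fun A B C =>
      Matrix.det !![α A, α B, α C; β A, β B, β C; γ A, γ B, γ C]
    𝒜.schouten (.wedge X Y) (.wedge Z W) α β γ =
      tri (𝒜.bracket X Z) Y W - tri (𝒜.bracket X W) Y Z
        - tri (𝒜.bracket Y Z) X W + tri (𝒜.bracket Y W) X Z := by
  simp only [schouten, lieDeriv, Bivector.wedge, LinearMap.coe_mk, AddHom.coe_mk,
    Matrix.det_fin_three, Matrix.of_apply, Matrix.cons_val]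
  simp only [sub_eq_add_neg, ← neg_smul, 𝒜.add_bracket, 𝒜.bracket_add, 𝒜.leibniz, 𝒜.leibniz_left,
    map_add, map_smul, map_neg, Derivation.leibniz, smul_eq_mul, Derivation.add_apply,
    Derivation.smul_apply, 𝒜.bracket_swap Z X, 𝒜.bracket_swap Z Y, 𝒜.bracket_swap W X,
    𝒜.bracket_swap W Y]
  ring

/-- `π` is a Poisson bivector: `[π, π] = 0`. -/
def IsPoisson (𝒜 : SkewAlgebroid R L) (π : Bivector R L) : Prop :=
  ∀ α β γ : Module.Dual R L, 𝒜.schouten π π α β γ = 0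

/-- `(π, N, ψ, H)` is a Poisson quasi-Nijenhuis structure with background. The signs of
`concomitant_eq` and `torsion_eq` are those of the big bracket form of the definition. -/
structure IsPoissonQuasiNijenhuisWithBackground (𝒜 : SkewAlgebroid R L) (π : Bivector R L) (N : L →ₗ[R] L)
    (ψ H : KForm R L 3) : Prop where
  /-- `N ∘ π♯ = π♯ ∘ ᵗN` -/
  comm : ∀ α : Module.Dual R L, N (π.sharp α) = π.sharp (α ∘ₗ N)
  closed_psi : ∀ W X Y Z : L, 𝒜.d₃ ψ W X Y Z = 0
  closed_background : ∀ W X Y Z : L, 𝒜.d₃ H W X Y Z = 0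
  poisson : 𝒜.IsPoisson π
  /-- `C_{π,N}(α,β) = 2 H(π♯α, π♯β, ·)` -/
  concomitant_eq : ∀ α β : Module.Dual R L,
    𝒜.concomitant π N α β = (2 : R) • contract H (π.sharp α) (π.sharp β)
  /-- `T_N(X,Y) = -π♯(H(NX,Y,·) - H(NY,X,·) + ψ(X,Y,·))` -/
  torsion_eq : ∀ X Y : L,
    𝒜.torsion N X Y =
      -π.sharp (contract H (N X) Y - contract H (N Y) X + contract ψ X Y)
  /-- `d_N ψ = d𝓗` -/
  differential_eq : ∀ W X Y Z : L,
    (𝒜.deform N).d₃ ψ W X Y Z = 𝒜.d₃ (cyclicForm N H) W X Y Z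

end SkewAlgebroid

/-!
# Lie algebroids over a smooth manifold
-/

section Geometry

open scoped ContDiff

variable {E : Type*} [NormedAddCommGroup E] [NormedSpace ℝ E]
  {M : Type*} [TopologicalSpace M] [ChartedSpace E M]
  {F : Type*} [NormedAddCommGroup F] [NormedSpace ℝ F]
  {A : M → Type*} [TopologicalSpace (Bundle.TotalSpace F A)] [∀ x, TopologicalSpace (A x)]
  [FiberBundle F A] [∀ x, AddCommGroup (A x)] [∀ x, Module ℝ (A x)] [VectorBundle ℝ F A]

/-- The ring `C^∞(M)`. -/
abbrev Fun (E M : Type*) [NormedAddCommGroup E] [NormedSpace ℝ E] [TopologicalSpace M]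
    [ChartedSpace E M] : Type _ :=
  C^∞⟮𝓘(ℝ, E), M; ℝ⟯

/-- The smooth sections `Γ(A)` of the vector bundle `A → M` with model fibre `F`. -/
abbrev Sec (E F : Type*) {M : Type*} [NormedAddCommGroup E] [NormedSpace ℝ E]
    [TopologicalSpace M] [ChartedSpace E M] [NormedAddCommGroup F] [NormedSpace ℝ F]
    (A : M → Type*) [TopologicalSpace (Bundle.TotalSpace F A)] [∀ x, TopologicalSpace (A x)]
    [FiberBundle F A] : Type _ :=
  Cₛ^∞⟮𝓘(ℝ, E); F, A⟯

theorem Fun.mdifferentiableAt (f : Fun E M) (x : M) :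
    MDifferentiableAt 𝓘(ℝ, E) 𝓘(ℝ, ℝ) f x :=
  f.contMDiff.mdifferentiableAt (by simp)

/-- Pointwise multiplication of a section by a function. -/
instance : SMul (Fun E M) (Sec E F A) :=
  ⟨fun f s => ⟨fun x => f x • s x, ContMDiff.smul_section f.contMDiff s.contMDiff⟩⟩

theorem Sec.smul_apply (f : Fun E M) (s : Sec E F A) (x : M) : (f • s) x = f x • s x := rfl

instance : Module (Fun E M) (Sec E F A) where
  smul_add c f g := by ext x; exact smul_add (c x) (f x) (g x)
  add_smul c₁ c₂ f := by ext x; exact add_smul (c₁ x) (c₂ x) (f x)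
  mul_smul c₁ c₂ f := by ext x; exact mul_smul (c₁ x) (c₂ x) (f x)
  one_smul f := by ext x; exact one_smul ℝ (f x)
  zero_smul f := by ext x; exact zero_smul ℝ (f x)
  smul_zero r := by ext x; exact smul_zero (r x)

/-- A smooth vector bundle morphism `A → TM` over the identity of `M`. -/
structure Anchor (E F : Type*) {M : Type*} [NormedAddCommGroup E] [NormedSpace ℝ E]
    [TopologicalSpace M] [ChartedSpace E M] [IsManifold 𝓘(ℝ, E) ∞ M]
    [NormedAddCommGroup F] [NormedSpace ℝ F]
    (A : M → Type*) [TopologicalSpace (Bundle.TotalSpace F A)] [∀ x, TopologicalSpace (A x)]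
    [FiberBundle F A] [∀ x, AddCommGroup (A x)] [∀ x, Module ℝ (A x)] [VectorBundle ℝ F A] where
  toFun : ∀ x : M, A x →ₗ[ℝ] TangentSpace 𝓘(ℝ, E) x
  smooth : ContMDiff (𝓘(ℝ, E).prod 𝓘(ℝ, F)) 𝓘(ℝ, E).tangent ∞
    (fun v : Bundle.TotalSpace F A => (⟨v.proj, toFun v.proj v.snd⟩ : TangentBundle 𝓘(ℝ, E) M))

variable [IsManifold 𝓘(ℝ, E) ∞ M]

/-- The function `ρ(X) f`, whose value at `x` is `df_x (ρ_x (X_x))`. -/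
def Anchor.apply (ρ : Anchor E F A) (X : Sec E F A) (f : Fun E M) : Fun E M where
  val x := mvfderiv 𝓘(ℝ, E) f x (ρ.toFun x (X x))
  property := by
    have h₁ := ρ.smooth.comp X.contMDiff
    have h₂ := (f.contMDiff.contMDiff_tangentMap (m := ∞) (by simp)).comp h₁
    exact (contMDiff_snd_tangentBundle_modelSpace ℝ 𝓘(ℝ, ℝ)).comp h₂

theorem Anchor.apply_apply (ρ : Anchor E F A) (X : Sec E F A) (f : Fun E M) (x : M) :
    ρ.apply X f x = mvfderiv 𝓘(ℝ, E) f x (ρ.toFun x (X x)) := rfl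

/-- The action of the sections of `A` on functions through the anchor. -/
def Anchor.deriv (ρ : Anchor E F A) : Sec E F A →ₗ[Fun E M] Derivation ℝ (Fun E M) (Fun E M) where
  toFun X := Derivation.mk'
    { toFun := ρ.apply X
      map_add' := fun f g => by
        ext x
        have h := mvfderiv_add (f.mdifferentiableAt x) (g.mdifferentiableAt x)
        exact congrArg (fun T => T (ρ.toFun x (X x))) h
      map_smul' := fun c f => by
        ext x
        have h : mvfderiv 𝓘(ℝ, E) (fun y => c • f y) x = c • mvfderiv 𝓘(ℝ, E) f x := by
          have := mvfderiv_smul (mdifferentiableAt_const (c := c)) (f.mdifferentiableAt x)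
          rw [mvfderiv_const] at this
          simpa using! this
        exact congrArg (fun T => T (ρ.toFun x (X x))) h }
    (fun f g => by
      ext x
      have h := mvfderiv_mul (f.mdifferentiableAt x) (g.mdifferentiableAt x)
      exact congrArg (fun T => T (ρ.toFun x (X x))) h)
  map_add' X Y := by
    ext f x
    change mvfderiv 𝓘(ℝ, E) f x (ρ.toFun x (X x + Y x)) = _
    rw [map_add, map_add]
    rfl
  map_smul' g X := by
    ext f x
    change mvfderiv 𝓘(ℝ, E) f x (ρ.toFun x (g x • X x)) = _
    rw [map_smul, map_smul]
    rfl

/-- A Lie algebroid structure on the vector bundle `A → M`: a Lie bracket on `Γ(A)` and an anchor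
`A → TM` which satisfy the Leibniz rule, the anchor being compatible with the brackets of sections
and of vector fields (viewed as derivations of `C^∞(M)`). -/
structure LieAlgebroid (E F : Type*) {M : Type*} [NormedAddCommGroup E] [NormedSpace ℝ E]
    [TopologicalSpace M] [ChartedSpace E M] [IsManifold 𝓘(ℝ, E) ∞ M]
    [NormedAddCommGroup F] [NormedSpace ℝ F]
    (A : M → Type*) [TopologicalSpace (Bundle.TotalSpace F A)] [∀ x, TopologicalSpace (A x)]
    [FiberBundle F A] [∀ x, AddCommGroup (A x)] [∀ x, Module ℝ (A x)] [VectorBundle ℝ F A] where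
  bracket : Sec E F A → Sec E F A → Sec E F A
  anchor : Anchor E F A
  add_bracket : ∀ X X' Y, bracket (X + X') Y = bracket X Y + bracket X' Y
  bracket_add : ∀ X Y Y', bracket X (Y + Y') = bracket X Y + bracket X Y'
  bracket_self : ∀ X, bracket X X = 0
  jacobi : ∀ X Y Z,
    bracket X (bracket Y Z) + bracket Y (bracket Z X) + bracket Z (bracket X Y) = 0
  leibniz : ∀ (X Y : Sec E F A) (f : Fun E M),
    bracket X (f • Y) = f • bracket X Y + anchor.deriv X f • Y
  anchor_bracket : ∀ X Y, anchor.deriv (bracket X Y) = ⁅anchor.deriv X, anchor.deriv Y⁆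

/-- The bracket and the anchor of a Lie algebroid, on the `C^∞(M)`-module `Γ(A)`. -/
def LieAlgebroid.toSkew (𝒜 : LieAlgebroid E F A) : SkewAlgebroid (Fun E M) (Sec E F A) where
  bracket := 𝒜.bracket
  anchor := 𝒜.anchor.deriv
  add_bracket := 𝒜.add_bracket
  bracket_add := 𝒜.bracket_add
  bracket_self := 𝒜.bracket_self
  leibniz := 𝒜.leibniz

end Geometry

end PqN

end

/-!
Two facts carry the proof. First, `[π,π] = 0` says that `π♯` is a morphism from `[·,·]_π` to the
bracket of `A`. Secondly, Cartan's formula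
`dω(X,Y,·) = 𝓛_X(ω♭Y) - 𝓛_Y(ω♭X) - d(ω(Y,X)) - ω♭[X,Y]` has the shape of `[·,·]_π`, so that, for
every bivector `π`, it gives identities between `1`-forms:
* `C_{π,N}(α,β) = 2(ᵗN[α,β]_π - ω♭[π♯α,π♯β] - dω(π♯α,π♯β,·))`, where the first two terms cancel if
  `π` is Poisson because `ᵗN = ω♭ ∘ π♯`;
* `ω♭[X,Y]_N - [ω♭X,ω♭Y]_π = H(NX,Y,·) - H(NY,X,·) + dω_N(X,Y,·)`, whose image under `-π♯` is the
  torsion formula.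

For the last equation, `d_N = i_N d - d i_N` gives `d_N dω_N = -d(i_N dω_N)`, and the Poisson
condition evaluated on `ω♭X, ω♭Y, ω♭Z` says that `i_N dω_N + 𝓗` is the exact form `d(ω(N·,N·))`.
-/

noncomputable section

namespace PqN

section Forms

variable {R L : Type*} [CommRing R] [AddCommGroup L] [Module R L]

theorem KForm.neg₁ (η : KForm R L 2) (x y : L) : η ![-x, y] = -η ![x, y] := by
  rw [← neg_one_smul R x, η.smul₁, neg_one_mul]

theorem KForm.neg₃₁ (η : KForm R L 3) (x y z : L) : η ![-x, y, z] = -η ![x, y, z] := by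
  rw [← neg_one_smul R x, η.smul₃₁, neg_one_mul]

theorem KForm.swap₃₁₂ (η : KForm R L 3) (x y z : L) : η ![x, y, z] = -η ![y, x, z] := by
  have h := η.self₃₁₂ (x + y) z
  rw [η.add₃₁, η.add₃₂, η.add₃₂, η.self₃₁₂, η.self₃₁₂] at h
  linear_combination h

theorem KForm.swap₃₂₃ (η : KForm R L 3) (x y z : L) : η ![x, y, z] = -η ![x, z, y] := by
  have h := η.self₃₂₃ x (y + z)
  rw [η.add₃₂, η.add₃₃, η.add₃₃, η.self₃₂₃, η.self₃₂₃] at h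
  linear_combination h

theorem KForm.swap₃₁₃ (η : KForm R L 3) (x y z : L) : η ![x, y, z] = -η ![z, y, x] := by
  rw [η.swap₃₁₂, η.swap₃₂₃, η.swap₃₁₂, neg_neg]

theorem KForm.ext₃ {η θ : KForm R L 3} (h : ∀ X Y Z, η ![X, Y, Z] = θ ![X, Y, Z]) : η = θ := by
  ext v
  have hv : ![v 0, v 1, v 2] = v := FinVec.etaExpand_eq v
  rw [← hv]
  exact h _ _ _

theorem KForm.compLinearMap_apply₂ (ω : KForm R L 2) (N : L →ₗ[R] L) (X Y : L) :
    ω.compLinearMap N ![X, Y] = ω ![N X, N Y] := by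
  rw [AlternatingMap.compLinearMap_apply]
  congr 1
  ext i
  fin_cases i <;> rfl

theorem flat_apply (ω : KForm R L 2) (X Y : L) : flat ω X Y = ω ![X, Y] := rfl

theorem contract_apply (η : KForm R L 3) (X Y Z : L) : contract η X Y Z = η ![X, Y, Z] := rfl

theorem contract_neg (η : KForm R L 3) (X Y : L) : contract (-η) X Y = -contract η X Y := rfl

theorem cyclicForm_apply (N : L →ₗ[R] L) (H : KForm R L 3) (X Y Z : L) :
    cyclicForm N H ![X, Y, Z] = H ![N X, N Y, Z] + H ![N Y, N Z, X] + H ![N Z, N X, Y] := rfl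

/-- The contraction `i_N η` of a `3`-form with an endomorphism `N`, that is, the extension of `ᵗN`
to a derivation of degree `0` of the exterior algebra. -/
def insertForm (N : L →ₗ[R] L) (η : KForm R L 3) : KForm R L 3 :=
  mkForm₃ (fun X Y Z => η ![N X, Y, Z] + η ![X, N Y, Z] + η ![X, Y, N Z])
    (by intros; simp only [map_add, η.add₃₁]; ring)
    (by intros; simp only [map_smul, η.smul₃₁]; ring)
    (by intros; simp only [map_add, η.add₃₂]; ring)
    (by intros; simp only [map_smul, η.smul₃₂]; ring)
    (by intros; simp only [map_add, η.add₃₃]; ring)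
    (by intros; simp only [map_smul, η.smul₃₃]; ring)
    (by intro X Z; rw [η.self₃₁₂, η.swap₃₁₂ (N X)]; ring)
    (by intro X Y; rw [η.self₃₂₃, η.swap₃₂₃ X (N Y)]; ring)
    (by intro X Y; rw [η.self₃₁₃, η.swap₃₁₃ (N X)]; ring)

theorem insertForm_apply (N : L →ₗ[R] L) (η : KForm R L 3) (X Y Z : L) :
    insertForm N η ![X, Y, Z] = η ![N X, Y, Z] + η ![X, N Y, Z] + η ![X, Y, N Z] := rfl

end Forms

namespace Bivector

variable {R L : Type*} [CommRing R] [AddCommGroup L] [Module R L]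
  (π : Bivector R L) (ω : KForm R L 2)

theorem sharp_flat (X : L) : π.sharp (flat ω X) = π.endo ω X := rfl

theorem flat_twistedForm (X : L) : flat (π.twistedForm ω) X = flat ω (π.endo ω X) := rfl

theorem twistedForm_apply (X Y : L) : π.twistedForm ω ![X, Y] = ω ![π.endo ω X, Y] := rfl

theorem dual_comp_endo (α : Module.Dual R L) : α ∘ₗ π.endo ω = flat ω (π.sharp α) := by
  ext X
  rw [LinearMap.comp_apply, ← π.sharp_flat, π.eval_swap, flat_apply, flat_apply, ← ω.swap₂]

theorem endo_sharp (α : Module.Dual R L) : π.endo ω (π.sharp α) = π.sharp (α ∘ₗ π.endo ω) := by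
  rw [π.dual_comp_endo, π.sharp_flat]

theorem form_endo_right (X Y : L) : ω ![X, π.endo ω Y] = ω ![π.endo ω X, Y] :=
  LinearMap.congr_fun (π.dual_comp_endo ω (flat ω X)) Y

theorem form_endo_swap (X Y : L) : ω ![π.endo ω X, Y] = -ω ![π.endo ω Y, X] := by
  rw [← π.form_endo_right, ω.swap₂]

end Bivector

namespace SkewAlgebroid

variable {R L : Type*} [CommRing R] [Algebra ℝ R] [AddCommGroup L] [Module R L]

section CartanCalculus

variable (𝒜 : SkewAlgebroid R L)

theorem neg_bracket (X Y : L) : 𝒜.bracket (-X) Y = -𝒜.bracket X Y := by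
  simpa using 𝒜.leibniz_left X Y (-1)

theorem d₀_apply (f : R) (X : L) : 𝒜.d₀ f X = 𝒜.anchor X f := rfl

theorem d₀_neg (f : R) : 𝒜.d₀ (-f) = -𝒜.d₀ f :=
  LinearMap.ext fun X => map_neg (𝒜.anchor X) f

theorem lieDeriv_apply (X : L) (α : Module.Dual R L) (Y : L) :
    𝒜.lieDeriv X α Y = 𝒜.anchor X (α Y) - α (𝒜.bracket X Y) := rfl

theorem d₂_apply (ω : KForm R L 2) (X Y Z : L) :
    𝒜.d₂ ω ![X, Y, Z] =
      𝒜.anchor X (ω ![Y, Z]) - 𝒜.anchor Y (ω ![X, Z]) + 𝒜.anchor Z (ω ![X, Y])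
        - ω ![𝒜.bracket X Y, Z] + ω ![𝒜.bracket X Z, Y] - ω ![𝒜.bracket Y Z, X] := rfl

theorem contract_d₂ (ω : KForm R L 2) (X Y : L) :
    contract (𝒜.d₂ ω) X Y =
      𝒜.lieDeriv X (flat ω Y) - 𝒜.lieDeriv Y (flat ω X) - 𝒜.d₀ (ω ![Y, X])
        - flat ω (𝒜.bracket X Y) := by
  ext Z
  simp only [contract_apply, d₂_apply, LinearMap.sub_apply, lieDeriv_apply, d₀_apply, flat_apply]
  rw [ω.swap₂ Y X, ω.swap₂ Y (𝒜.bracket X Z), ω.swap₂ X (𝒜.bracket Y Z), map_neg]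
  ring

theorem d₃_add (η θ : KForm R L 3) (W X Y Z : L) :
    𝒜.d₃ (η + θ) W X Y Z = 𝒜.d₃ η W X Y Z + 𝒜.d₃ θ W X Y Z := by
  simp only [d₃, AlternatingMap.add_apply, map_add]
  ring

theorem d₃_neg (η : KForm R L 3) (W X Y Z : L) : 𝒜.d₃ (-η) W X Y Z = -𝒜.d₃ η W X Y Z := by
  simp only [d₃, AlternatingMap.neg_apply, map_neg]
  ring

end CartanCalculus

section LieRinehart

/-- The bracket and the anchor make `(R, L)` a Lie–Rinehart algebra, the algebraic counterpart of
a Lie algebroid. Mathlib's `LieRinehartAlgebra` would require the bracket as a `LieRing` instance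
on `L`, hence this predicate. -/
structure IsLieRinehart (𝒜 : SkewAlgebroid R L) : Prop where
  jacobi : ∀ X Y Z, 𝒜.bracket X (𝒜.bracket Y Z) + 𝒜.bracket Y (𝒜.bracket Z X)
    + 𝒜.bracket Z (𝒜.bracket X Y) = 0
  anchor_bracket : ∀ X Y, 𝒜.anchor (𝒜.bracket X Y) = ⁅𝒜.anchor X, 𝒜.anchor Y⁆

variable {𝒜 : SkewAlgebroid R L}

theorem IsLieRinehart.jacobi_left (h𝒜 : 𝒜.IsLieRinehart) (X Y Z : L) :
    𝒜.bracket (𝒜.bracket X Y) Z - 𝒜.bracket (𝒜.bracket X Z) Y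
      + 𝒜.bracket (𝒜.bracket Y Z) X = 0 := by
  rw [← neg_eq_zero, ← h𝒜.jacobi X Y Z, 𝒜.bracket_swap X (𝒜.bracket Y Z),
    𝒜.bracket_swap Z (𝒜.bracket X Y), 𝒜.bracket_swap Y (𝒜.bracket Z X), 𝒜.bracket_swap Z X,
    𝒜.neg_bracket]
  abel

theorem IsLieRinehart.d₃_d₂ (h𝒜 : 𝒜.IsLieRinehart) (ω : KForm R L 2) (W X Y Z : L) :
    𝒜.d₃ (𝒜.d₂ ω) W X Y Z = 0 := by
  have jacobi_form (X Y Z V : L) : ω ![𝒜.bracket (𝒜.bracket X Y) Z, V]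
      - ω ![𝒜.bracket (𝒜.bracket X Z) Y, V] + ω ![𝒜.bracket (𝒜.bracket Y Z) X, V] = 0 := by
    simpa only [map_add, map_sub, map_zero, LinearMap.add_apply, LinearMap.sub_apply,
      LinearMap.zero_apply, flat_apply] using
      congrArg (fun U => flat ω U V) (h𝒜.jacobi_left X Y Z)
  simp only [d₃, d₂_apply, map_add, map_sub, h𝒜.anchor_bracket, Derivation.commutator_apply]
  rw [ω.swap₂ (𝒜.bracket W X) (𝒜.bracket Y Z), ω.swap₂ (𝒜.bracket W Y) (𝒜.bracket X Z),
    ω.swap₂ (𝒜.bracket W Z) (𝒜.bracket X Y)]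
  linear_combination
    jacobi_form W X Y Z - jacobi_form W X Z Y + jacobi_form W Y Z X - jacobi_form X Y Z W

end LieRinehart

section Deformation

variable (𝒜 : SkewAlgebroid R L) (N : L →ₗ[R] L)

theorem deform_bracket (X Y : L) :
    (𝒜.deform N).bracket X Y = 𝒜.bracket (N X) Y + 𝒜.bracket X (N Y) - N (𝒜.bracket X Y) := rfl

theorem deform_anchor (X : L) : (𝒜.deform N).anchor X = 𝒜.anchor (N X) := rfl

theorem torsion_eq_bracket_sub_deform_bracket (X Y : L) :
    𝒜.torsion N X Y = 𝒜.bracket (N X) (N Y) - N ((𝒜.deform N).bracket X Y) := rfl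

theorem deform_d₀ (f : R) : (𝒜.deform N).d₀ f = 𝒜.d₀ f ∘ₗ N := rfl

theorem deform_lieDeriv (X : L) (α : Module.Dual R L) :
    (𝒜.deform N).lieDeriv X α =
      𝒜.lieDeriv (N X) α + 𝒜.lieDeriv X α ∘ₗ N - 𝒜.lieDeriv X (α ∘ₗ N) := by
  ext Y
  simp only [lieDeriv_apply, deform_bracket, deform_anchor, LinearMap.add_apply,
    LinearMap.sub_apply, LinearMap.comp_apply, map_add, map_sub]
  ring

theorem deform_d₃ (η : KForm R L 3) (W X Y Z : L) :
    (𝒜.deform N).d₃ η W X Y Z =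
      𝒜.d₃ η (N W) X Y Z + 𝒜.d₃ η W (N X) Y Z + 𝒜.d₃ η W X (N Y) Z + 𝒜.d₃ η W X Y (N Z)
        - 𝒜.d₃ (insertForm N η) W X Y Z := by
  simp only [d₃, insertForm_apply, deform_bracket, deform_anchor, map_add, η.add₃₁,
    sub_eq_add_neg, η.neg₃₁]
  ring

theorem concomitant_of_endo_comm (π : Bivector R L)
    (comm : ∀ α : Module.Dual R L, N (π.sharp α) = π.sharp (α ∘ₗ N)) (α β : Module.Dual R L) :
    𝒜.concomitant π N α β =
      (2 : R) • (𝒜.formBracket π α β ∘ₗ N - (𝒜.lieDeriv (π.sharp α) (β ∘ₗ N)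
        - 𝒜.lieDeriv (π.sharp β) (α ∘ₗ N) - 𝒜.d₀ (π.eval α (β ∘ₗ N)))) := by
  have eval_comm : π.eval (α ∘ₗ N) β = π.eval α (β ∘ₗ N) := by
    simp only [Bivector.eval, ← comm, LinearMap.comp_apply]
  simp only [concomitant, formBracket, deform_lieDeriv, deform_d₀, comm, eval_comm,
    LinearMap.sub_comp]
  module

end Deformation

section Poisson

variable {𝒜 : SkewAlgebroid R L} {π : Bivector R L}

theorem formBracket_flat_sub_flat_deform_bracket (𝒜 : SkewAlgebroid R L) (π : Bivector R L)
    (ω : KForm R L 2) (X Y : L) :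
    𝒜.formBracket π (flat ω X) (flat ω Y) - flat ω ((𝒜.deform (π.endo ω)).bracket X Y) =
      contract (𝒜.d₂ ω) (π.endo ω X) Y - contract (𝒜.d₂ ω) (π.endo ω Y) X
        - contract (𝒜.d₂ (π.twistedForm ω)) X Y := by
  have hω : 𝒜.d₀ (ω ![X, π.endo ω Y]) = -𝒜.d₀ (ω ![π.endo ω Y, X]) := by
    rw [ω.swap₂, d₀_neg]
  simp only [contract_d₂, formBracket, Bivector.eval, π.sharp_flat, π.flat_twistedForm,
    π.twistedForm_apply, flat_apply, deform_bracket, 𝒜.bracket_swap (π.endo ω Y) X,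
    map_add, map_sub, map_neg, hω]
  abel

theorem IsPoisson.lieDeriv_cyclic (hπ : 𝒜.IsPoisson π) (α β γ : Module.Dual R L) :
    𝒜.lieDeriv (π.sharp α) β (π.sharp γ) + 𝒜.lieDeriv (π.sharp β) γ (π.sharp α)
      + 𝒜.lieDeriv (π.sharp γ) α (π.sharp β) = 0 := by
  refine (smul_eq_zero_iff_right (two_ne_zero (α := ℝ))).1 ?_
  rw [two_smul, ← hπ α β γ, schouten]
  ring

theorem IsPoisson.apply_sharp_formBracket (hπ : 𝒜.IsPoisson π) (α β γ : Module.Dual R L) :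
    γ (π.sharp (𝒜.formBracket π α β)) = γ (𝒜.bracket (π.sharp α) (π.sharp β)) := by
  have h := hπ.lieDeriv_cyclic α β γ
  rw [π.eval_swap]
  simp only [formBracket, lieDeriv_apply, d₀_apply, LinearMap.sub_apply, Bivector.eval] at h ⊢
  rw [𝒜.bracket_swap (π.sharp β) (π.sharp α), 𝒜.bracket_swap (π.sharp γ) (π.sharp β),
    π.eval_swap α γ, π.eval_swap β α] at h
  simp only [map_neg] at h
  linear_combination -h

theorem IsPoisson.sharp_formBracket (hπ : 𝒜.IsPoisson π)
    (dual_separates : Function.Injective (Module.Dual.eval R L)) (α β : Module.Dual R L) :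
    π.sharp (𝒜.formBracket π α β) = 𝒜.bracket (π.sharp α) (π.sharp β) :=
  dual_separates (LinearMap.ext (hπ.apply_sharp_formBracket α β))

theorem IsPoisson.formBracket_comp_endo (hπ : 𝒜.IsPoisson π) (ω : KForm R L 2)
    (α β : Module.Dual R L) :
    𝒜.formBracket π α β ∘ₗ π.endo ω = flat ω (𝒜.bracket (π.sharp α) (π.sharp β)) := by
  ext X
  have h := hπ.apply_sharp_formBracket α β (flat ω X)
  rw [π.dual_comp_endo, flat_apply, flat_apply, ω.swap₂, ω.swap₂ _ X]
  exact congrArg Neg.neg h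

theorem IsPoisson.concomitant_endo (hπ : 𝒜.IsPoisson π) (ω : KForm R L 2)
    (α β : Module.Dual R L) :
    𝒜.concomitant π (π.endo ω) α β =
      (2 : R) • contract (-𝒜.d₂ ω) (π.sharp α) (π.sharp β) := by
  rw [𝒜.concomitant_of_endo_comm _ π (π.endo_sharp ω), hπ.formBracket_comp_endo, contract_neg,
    contract_d₂]
  simp only [π.dual_comp_endo, Bivector.eval, flat_apply]
  module

theorem IsPoisson.torsion_endo (hπ : 𝒜.IsPoisson π)
    (dual_separates : Function.Injective (Module.Dual.eval R L)) (ω : KForm R L 2) (X Y : L) :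
    𝒜.torsion (π.endo ω) X Y =
      -π.sharp (contract (-𝒜.d₂ ω) (π.endo ω X) Y - contract (-𝒜.d₂ ω) (π.endo ω Y) X
        + contract (𝒜.d₂ (π.twistedForm ω)) X Y) :=
  calc 𝒜.torsion (π.endo ω) X Y
    _ = π.sharp (𝒜.formBracket π (flat ω X) (flat ω Y)
          - flat ω ((𝒜.deform (π.endo ω)).bracket X Y)) := by
      rw [torsion_eq_bracket_sub_deform_bracket, map_sub, hπ.sharp_formBracket dual_separates]
      rfl
    _ = _ := by
      rw [formBracket_flat_sub_flat_deform_bracket, ← map_neg, contract_neg, contract_neg]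
      congr 1
      abel

theorem IsPoisson.insertForm_add_cyclicForm (hπ : 𝒜.IsPoisson π) (ω : KForm R L 2) :
    insertForm (π.endo ω) (𝒜.d₂ (π.twistedForm ω)) + cyclicForm (π.endo ω) (-𝒜.d₂ ω) =
      𝒜.d₂ (ω.compLinearMap (π.endo ω)) := by
  refine KForm.ext₃ fun X Y Z => ?_
  have h := hπ.lieDeriv_cyclic (flat ω X) (flat ω Y) (flat ω Z)
  simp only [π.sharp_flat, lieDeriv_apply, AlternatingMap.add_apply, insertForm_apply,
    cyclicForm_apply, AlternatingMap.neg_apply, d₂_apply, flat_apply,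
    π.twistedForm_apply, ω.compLinearMap_apply₂, π.form_endo_right] at h ⊢
  rw [ω.swap₂ Y (𝒜.bracket _ _), ω.swap₂ Z (𝒜.bracket _ _), ω.swap₂ X (𝒜.bracket _ _),
    𝒜.bracket_swap (π.endo ω Y) (π.endo ω X), 𝒜.bracket_swap (π.endo ω Z) (π.endo ω Y),
    π.form_endo_swap ω Z X] at h
  rw [𝒜.bracket_swap (π.endo ω Y) X, 𝒜.bracket_swap (π.endo ω Z) X,
    𝒜.bracket_swap (π.endo ω Z) Y, 𝒜.bracket_swap (π.endo ω Z) (π.endo ω X),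
    π.form_endo_swap ω Z X, π.form_endo_swap ω Y X, π.form_endo_swap ω Z Y,
    π.form_endo_swap ω (π.endo ω Z) X, π.form_endo_right]
  simp only [map_neg, ω.neg₁] at h ⊢
  linear_combination -h

theorem IsPoisson.deform_d₃_d₂_twistedForm (hπ : 𝒜.IsPoisson π) (h𝒜 : 𝒜.IsLieRinehart)
    (ω : KForm R L 2) (W X Y Z : L) :
    (𝒜.deform (π.endo ω)).d₃ (𝒜.d₂ (π.twistedForm ω)) W X Y Z =
      𝒜.d₃ (cyclicForm (π.endo ω) (-𝒜.d₂ ω)) W X Y Z := by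
  have h := h𝒜.d₃_d₂ (ω.compLinearMap (π.endo ω)) W X Y Z
  rw [← hπ.insertForm_add_cyclicForm ω, d₃_add] at h
  simp only [deform_d₃, h𝒜.d₃_d₂]
  linear_combination -h

end Poisson

end SkewAlgebroid

section Geometry

open scoped ContDiff

variable {E : Type*} [NormedAddCommGroup E] [NormedSpace ℝ E]
  {M : Type*} [TopologicalSpace M] [ChartedSpace E M]
  {F : Type*} [NormedAddCommGroup F] [NormedSpace ℝ F]
  {A : M → Type*} [TopologicalSpace (Bundle.TotalSpace F A)] [∀ x, TopologicalSpace (A x)]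
  [FiberBundle F A] [∀ x, AddCommGroup (A x)] [∀ x, Module ℝ (A x)] [VectorBundle ℝ F A]

theorem LieAlgebroid.isLieRinehart_toSkew [IsManifold 𝓘(ℝ, E) ∞ M] (𝒜 : LieAlgebroid E F A) :
    𝒜.toSkew.IsLieRinehart :=
  ⟨𝒜.jacobi, 𝒜.anchor_bracket⟩

section CutoffDual

variable [ContMDiffVectorBundle ∞ F A 𝓘(ℝ, E)]
  (e : Bundle.Trivialization F (Bundle.TotalSpace.proj : Bundle.TotalSpace F A → M))
  [MemTrivializationAtlas e] {χ : Fun E M}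

theorem contMDiff_mul_dual_linearMapAt (hχ : tsupport χ ⊆ e.baseSet) (φ : StrongDual ℝ F)
    (Y : Sec E F A) :
    ContMDiff 𝓘(ℝ, E) 𝓘(ℝ, ℝ) ∞ fun x => χ x * φ (e.linearMapAt ℝ x (Y x)) := by
  refine contMDiff_of_tsupport fun x hx => ?_
  have hxe : x ∈ e.baseSet := hχ (tsupport_mul_subset_left hx)
  have smooth_coord : ContMDiffAt 𝓘(ℝ, E) 𝓘(ℝ, F) ∞ (fun y => (e ⟨y, Y y⟩).2) x :=
    (e.contMDiffAt_section_iff hxe).1 (Y.contMDiff x)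
  refine (χ.contMDiff.contMDiffAt.mul
    (φ.contMDiff.contMDiffAt.comp x smooth_coord)).congr_of_eventuallyEq ?_
  filter_upwards [e.open_baseSet.mem_nhds hxe] with y hy
  simp only [Function.comp_apply, Pi.mul_apply, e.coe_linearMapAt_of_mem (R := ℝ) hy]

/-- The section of `A*` which is the constant functional `φ` in the local trivialization `e`,
multiplied by a function `χ` supported in its base set. -/
def cutoffDual (hχ : tsupport χ ⊆ e.baseSet) (φ : StrongDual ℝ F) :
    Module.Dual (Fun E M) (Sec E F A) where
  toFun Y := ⟨_, contMDiff_mul_dual_linearMapAt e hχ φ Y⟩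
  map_add' Y Z := by
    ext x
    change χ x * φ (e.linearMapAt ℝ x (Y x + Z x)) =
      χ x * φ (e.linearMapAt ℝ x (Y x)) + χ x * φ (e.linearMapAt ℝ x (Z x))
    rw [map_add, map_add, mul_add]
  map_smul' f Y := by
    ext x
    change χ x * φ (e.linearMapAt ℝ x (f x • Y x)) = f x * (χ x * φ (e.linearMapAt ℝ x (Y x)))
    rw [map_smul, map_smul, smul_eq_mul, mul_left_comm]

end CutoffDual

theorem Sec.dual_eval_injective [FiniteDimensional ℝ E] [T2Space M] [IsManifold 𝓘(ℝ, E) ∞ M]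
    [ContMDiffVectorBundle ∞ F A 𝓘(ℝ, E)] :
    Function.Injective (Module.Dual.eval (Fun E M) (Sec E F A)) := by
  refine (injective_iff_map_eq_zero _).2 fun X hX => ?_
  ext x
  let e := trivializationAt F A x
  have hx : x ∈ e.baseSet := FiberBundle.mem_baseSet_trivializationAt' x
  obtain ⟨χ, hχ, -⟩ := (SmoothBumpFunction.nhds_basis_support (I := 𝓘(ℝ, E))
    (e.open_baseSet.mem_nhds hx)).mem_iff.1 Filter.univ_mem
  refine (e.continuousLinearEquivAt ℝ x hx).map_eq_zero_iff.1
    (SeparatingDual.eq_zero_of_forall_dual_eq_zero (R := ℝ) fun φ => ?_)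
  let α : Module.Dual (Fun E M) (Sec E F A) := cutoffDual e (χ := ⟨χ, χ.contMDiff⟩) hχ φ
  have hα : χ x * φ (e.linearMapAt ℝ x (X x)) = 0 :=
    congrArg (fun f : Fun E M => f x) (LinearMap.congr_fun hX α)
  simpa [e.coe_linearMapAt_of_mem (R := ℝ) hx] using hα

end Geometry

end PqN

end

theorem mainTheorem4_general {R L : Type*} [CommRing R] [Algebra ℝ R] [AddCommGroup L] [Module R L]
    {𝒜 : PqN.SkewAlgebroid R L} (h𝒜 : 𝒜.IsLieRinehart)
    (dual_separates : Function.Injective (Module.Dual.eval R L))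
    {π : PqN.Bivector R L} (hπ : 𝒜.IsPoisson π) (ω : PqN.KForm R L 2) :
    𝒜.IsPoissonQuasiNijenhuisWithBackground π (π.endo ω)
      (𝒜.d₂ (π.twistedForm ω)) (-𝒜.d₂ ω) where
  comm := π.endo_sharp ω
  closed_psi := h𝒜.d₃_d₂ _
  closed_background W X Y Z := by rw [𝒜.d₃_neg, h𝒜.d₃_d₂, neg_zero]
  poisson := hπ
  concomitant_eq := hπ.concomitant_endo ω
  torsion_eq := hπ.torsion_endo dual_separates ω
  differential_eq := hπ.deform_d₃_d₂_twistedForm h𝒜 ω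

theorem mainTheorem4
    {E : Type*} [NormedAddCommGroup E] [NormedSpace ℝ E] [FiniteDimensional ℝ E]
    {M : Type*} [TopologicalSpace M] [T2Space M] [SigmaCompactSpace M]
    [ChartedSpace E M] [IsManifold 𝓘(ℝ, E) ((⊤ : ℕ∞) : WithTop ℕ∞) M]
    {F : Type*} [NormedAddCommGroup F] [NormedSpace ℝ F] [FiniteDimensional ℝ F]
    {A : M → Type*} [TopologicalSpace (Bundle.TotalSpace F A)] [∀ x, TopologicalSpace (A x)]
    [FiberBundle F A] [∀ x, AddCommGroup (A x)] [∀ x, Module ℝ (A x)] [VectorBundle ℝ F A]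
    [ContMDiffVectorBundle ((⊤ : ℕ∞) : WithTop ℕ∞) F A 𝓘(ℝ, E)]
    (𝒜 : PqN.LieAlgebroid E F A)
    (π : PqN.Bivector (PqN.Fun E M) (PqN.Sec E F A)) (hπ : 𝒜.toSkew.IsPoisson π)
    (ω : PqN.KForm (PqN.Fun E M) (PqN.Sec E F A) 2) :
    𝒜.toSkew.IsPoissonQuasiNijenhuisWithBackground π (π.endo ω)
      (𝒜.toSkew.d₂ (π.twistedForm ω)) (-𝒜.toSkew.d₂ ω) :=
  mainTheorem4_general 𝒜.isLieRinehart_toSkew PqN.Sec.dual_eval_injective hπ ω
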